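/- Let $L$ be a first-order language, $\kappa$ a cardinal, and let $\bar M$ be a $\kappa$-saturated $L$-structure (the monster model); "small" means of cardinality $<\kappa$. Let $M\prec\bar M$ be a small elementary substructure and let $p(x)\in S_1(M)$ be a complete $1$-type over $M$. For a type $p\in S_1(N)$ over a structure $N$ and $X\subseteq N$ write $p\,|\,X$ for the set of formulas in $p$ with parameters from $X$, and put $$\mathrm{cl}_p(X)=\{a\in N : a\not\models p\,|\,X\},\qquad \mathrm{cl}_p^0(X)=X,\quad \mathrm{cl}_p^{n+1}(X)=\mathrm{cl}_p(\mathrm{cl}_p^n(X)),\qquad \mathrm{Cl}_p(X)=\bigcup_{n\in\omega}\mathrm{cl}_p^n(X).$$ Suppose that $(M,\mathrm{Cl}_p)$ is a pregeometry (i.e. $\mathrm{Cl}_p$ is monotone with $X\subseteq\mathrm{Cl}_p(X)$, has finite character, is idempotent, and satisfies exchange) which is infinite-dimensional (there is an infinite $I\subseteq M$ with $a\notin\mathrm{Cl}_p(I\setminus\{a\})$ for all $a\in I$). Then: 1. $p$ is definable: for every $L$-formula $\phi(x,\bar y)$ the set $\{\bar b\in M : \phi(x,\bar b)\in p\}$ is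 definable in $M$ with parameters from $M$. 2. $p$ has a unique heir $\bar p\in S_1(\bar M)$, i.e. a unique extension of $p$ to a complete type over $\bar M$ such that, for every formula $\phi(x,\bar y)$ with parameters from $M$, if $\phi(x,\bar c)\in\bar p$ for some $\bar c$ from $\bar M$, then $\phi(x,\bar b)\in p$ for some $\bar b$ from $M$. 3. $\bar p$ is generically stable: it is non-algebraic, and there is a small $A\subset\bar M$ such that $\bar p$ is $A$-invariant (whether $\phi(x,\bar b)\in\bar p$ depends only on $\phi$ and $\mathrm{tp}(\bar b/A)$) and, for every ordinal $\alpha$, every Morley sequence $(a_i : i<\alpha)$ in $\bar p$ over $A$ (that is, $a_i\in\bar M$ and $a_i\models\bar p\,|\,(A\cup\{a_j : j<i\})$ for all $i<\alpha$) and every formula $\phi(x)$ with parameters from $\bar M$, the set $\{i<\alpha : \bar M\models\phi(a_i)\}$ is finite or co-finite in $\alpha$. 4. $(\bar p(x),x=x)$ is strongly regular: $\bar p$ is non-algebraic and there is a small $A\subset\bar M$ such that $\bar p$ is $A$-invariant and for all $B$ with $A\subseteq B\subseteq\bar M$ and all $a\in\bar M$, either $a\models\bar p\,|\,B$ or $\bar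 p\,|\,B\vdash\bar p\,|\,(B\cup\{a\})$. -/

import Mathlib

open FirstOrder

universe u v w w'

namespace GlobalTypes

open FirstOrder.Language Cardinal

/-! ### Pregeometries -/

/-- `cl` is a pregeometry on the set `P`. -/
structure IsPregeometry {P : Type w} (cl : Set P → Set P) : Prop where
  subset_cl : ∀ A : Set P, A ⊆ cl A
  mono : ∀ A B : Set P, A ⊆ B → cl A ⊆ cl B
  finite_character : ∀ A : Set P, cl A = {a | ∃ F : Set P, F.Finite ∧ F ⊆ A ∧ a ∈ cl F}
  transitivity : ∀ A : Set P, cl (cl A) = cl A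
  exchange : ∀ (A : Set P) (a b : P),
    a ∈ cl (A ∪ {b}) → a ∉ cl A → b ∈ cl (A ∪ {a})

/-- `I` is independent (over the empty set). -/
def IsIndependent {P : Type w} (cl : Set P → Set P) (I : Set P) : Prop :=
  ∀ a ∈ I, a ∉ cl (I \ {a})

/-- For a pregeometry: the dimension, i.e. the common cardinality of the maximal independent
sets, is infinite. As every independent set is contained in a maximal one, this says that there
is an infinite independent set. -/
def IsInfiniteDimensional {P : Type w} (cl : Set P → Set P) : Prop :=
  ∃ I : Set P, I.Infinite ∧ IsIndependent cl I

/-! ### Complete 1-types over structures -/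

variable {L : FirstOrder.Language.{u, v}}

/-- `OneType L N` is `S₁(N)`: the complete 1-types over the structure `N`, i.e. the complete types
in one variable over the elementary diagram of `N` (which lives in the language with a constant
for each element of `N`). -/
abbrev OneType (L : FirstOrder.Language.{u, v}) (N : Type w) [L.Structure N] :=
  (L.elementaryDiagram N).CompleteType (Fin 1)

/-- The formula `φ(x, b)` with parameters from `N`, where `φ(x, y)` is an `L`-formula in the
variable `x` (index `Sum.inl 0`) and the variables `y` (indices `Sum.inr j`). -/
def inst {N : Type w} {γ : Type w'} (φ : L.Formula (Fin 1 ⊕ γ)) (b : γ → N) :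
    L[[N]].Formula (Fin 1) :=
  ((L.lhomWithConstants N).onFormula φ).subst
    (Sum.elim (fun i => Term.var i) (fun j => (L.con (b j)).term))

/-- `φ(x, b)` holds at `x = a` in `N`. -/
def Holds {N : Type w} [L.Structure N] {γ : Type w'} (φ : L.Formula (Fin 1 ⊕ γ)) (a : N)
    (b : γ → N) : Prop :=
  φ.Realize (Sum.elim (fun _ => a) b)

theorem realize_inst {N : Type w} [L.Structure N] {γ : Type w'} (φ : L.Formula (Fin 1 ⊕ γ))
    (b : γ → N) (a : N) : (inst φ b).Realize (fun _ => a) ↔ Holds φ a b := by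
  unfold inst Holds Formula.Realize
  rw [BoundedFormula.realize_subst]
  change ((L.lhomWithConstants N).onFormula φ).Realize _ ↔ φ.Realize _
  rw [LHom.realize_onFormula]
  refine iff_of_eq (congrArg _ ?_)
  funext i
  cases i with
  | inl i => simp
  | inr j => simp; rfl

section

variable {N : Type w} [L.Structure N]

/-- `φ(x, b) ∈ p`. -/
def InType (p : OneType L N) {γ : Type w'} (φ : L.Formula (Fin 1 ⊕ γ)) (b : γ → N) : Prop :=
  Formula.equivSentence (inst φ b) ∈ p

/-- `a ⊨ p | B`: the element `a` satisfies every formula in `p` with parameters from `B`. -/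
def Realizes (p : OneType L N) (B : Set N) (a : N) : Prop :=
  ∀ (n : ℕ) (φ : L.Formula (Fin 1 ⊕ Fin n)) (b : Fin n → N),
    (∀ i, b i ∈ B) → InType p φ b → Holds φ a b

/-- The operator `cl_p`, `cl_p(X) = {a ∈ N | a ⊭ p | X}`. -/
def clOp (p : OneType L N) (X : Set N) : Set N := {a | ¬ Realizes p X a}

/-- The operator `Cl_p`, `Cl_p(X) = ⋃ₙ cl_pⁿ(X)` with `cl_p⁰(X) = X`. -/
def ClOp (p : OneType L N) (X : Set N) : Set N := ⋃ n : ℕ, (clOp p)^[n] X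

/-- `p` is definable: for each `L`-formula `φ(x, y)` the set of `b` in `N` with `φ(x, b) ∈ p` is
definable in `N`, with parameters. -/
def IsDefinableType (p : OneType L N) : Prop :=
  ∀ (n : ℕ) (φ : L.Formula (Fin 1 ⊕ Fin n)),
    (Set.univ : Set N).Definable L {b : Fin n → N | InType p φ b}

/-- `p` contains no algebraic formula (one with only finitely many solutions). -/
def IsNonAlgebraic (p : OneType L N) : Prop :=
  ∀ (n : ℕ) (φ : L.Formula (Fin 1 ⊕ Fin n)) (b : Fin n → N),
    InType p φ b → {a : N | Holds φ a b}.Infinite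

/-- `q ∈ S₁(N)` is an heir of `p ∈ S₁(M)`: it extends `p`, and whenever a formula `φ(x, c, m)`
with `m` from `M` and `c` from `N` is in `q`, there is `b` from `M` with `φ(x, b, m) ∈ p`. -/
def IsHeir {M : L.ElementarySubstructure N} (p : OneType L M) (q : OneType L N) : Prop :=
  (∀ (n : ℕ) (φ : L.Formula (Fin 1 ⊕ Fin n)) (m : Fin n → M),
    InType p φ m → InType q φ (fun i => (m i : N))) ∧
  ∀ (n k : ℕ) (φ : L.Formula (Fin 1 ⊕ (Fin n ⊕ Fin k))) (c : Fin n → N) (m : Fin k → M),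
    InType q φ (Sum.elim c (fun i => (m i : N))) → ∃ b : Fin n → M, InType p φ (Sum.elim b m)

/-- `tp(b / A) = tp(b' / A)` for `n`-tuples `b`, `b'`. -/
def SameType (L : FirstOrder.Language.{u, v}) {N : Type w} [L.Structure N] (A : Set N) {n : ℕ}
    (b b' : Fin n → N) : Prop :=
  ∀ ψ : L[[A]].Formula (Fin n), ψ.Realize b ↔ ψ.Realize b'

/-- `p` is `A`-invariant, in the form "`p` does not split over `A`": whether `φ(x, b) ∈ p` depends
only on `tp(b / A)`. This implies invariance under `Aut(N / A)`, and is the same when `A` is small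
and `N` is a monster model. -/
def IsInvariant (A : Set N) (p : OneType L N) : Prop :=
  ∀ (n : ℕ) (φ : L.Formula (Fin 1 ⊕ Fin n)) (b b' : Fin n → N),
    SameType L A b b' → (InType p φ b ↔ InType p φ b')

/-- `(a i)`, indexed by the well-ordered set `ι`, is a Morley sequence in `p` over `A`
(used for `A`-invariant `p`): each `a i` realizes `p | A ∪ {a j | j < i}`. -/
def IsMorley (A : Set N) (p : OneType L N) {ι : Type w} [LinearOrder ι] (a : ι → N) : Prop :=
  ∀ i, Realizes p (A ∪ {c | ∃ j, j < i ∧ a j = c}) (a i)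

/-- The global type `p` is generically stable, where "small" means "of cardinality `< κ`".
(Morley sequences of non-algebraic types are injective, so every length of a Morley sequence
is the order type of some `ι : Type w`.) -/
def IsGenericallyStable (κ : Cardinal.{w}) (p : OneType L N) : Prop :=
  IsNonAlgebraic p ∧ ∃ A : Set N, #A < κ ∧ IsInvariant A p ∧
    ∀ (ι : Type w) [LinearOrder ι] [WellFoundedLT ι] (a : ι → N), IsMorley A p a →
      ∀ (n : ℕ) (φ : L.Formula (Fin 1 ⊕ Fin n)) (b : Fin n → N),
        {i | Holds φ (a i) b}.Finite ∨ {i | Holds φ (a i) b}ᶜ.Finite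

/-- `p | B ⊢ p | C`: every formula in `p` over `C` is implied, in `N`, by a formula in `p` over
`B` (note that `p | B` is closed under finite conjunctions). -/
def RestrEntails (p : OneType L N) (B C : Set N) : Prop :=
  ∀ (n : ℕ) (φ : L.Formula (Fin 1 ⊕ Fin n)) (c : Fin n → N), (∀ i, c i ∈ C) → InType p φ c →
    ∃ (m : ℕ) (ψ : L.Formula (Fin 1 ⊕ Fin m)) (b : Fin m → N), (∀ i, b i ∈ B) ∧ InType p ψ b ∧
      ∀ a : N, Holds ψ a b → Holds φ a c

/-- `(p(x), φ(x, d))` is strongly regular, where "small" means "of cardinality `< κ`". -/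
def IsStronglyRegular (κ : Cardinal.{w}) (p : OneType L N) {k : ℕ} (φ : L.Formula (Fin 1 ⊕ Fin k))
    (d : Fin k → N) : Prop :=
  IsNonAlgebraic p ∧ InType p φ d ∧ ∃ A : Set N, #A < κ ∧ (∀ i, d i ∈ A) ∧ IsInvariant A p ∧
    ∀ B : Set N, A ⊆ B → ∀ a : N, Holds φ a d →
      Realizes p B a ∨ RestrEntails p B (B ∪ {a})

/-- The formula `x = x`, without parameters. -/
def xEqx (L : FirstOrder.Language.{u, v}) : L.Formula (Fin 1 ⊕ Fin 0) :=
  (Term.var (Sum.inl 0)).equal (Term.var (Sum.inl 0))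

end

/-- `N` is `κ`-saturated: every set of formulas in one variable over fewer than `κ` parameters
which is finitely satisfiable in `N` is realized in `N`. -/
def IsSaturated (L : FirstOrder.Language.{u, v}) (κ : Cardinal.{w}) (N : Type w) [L.Structure N] : Prop :=
  ∀ A : Set N, #A < κ → ∀ S : Set (L[[A]].Formula (Fin 1)),
    (∀ F ⊆ S, F.Finite → ∃ a : N, ∀ φ ∈ F, φ.Realize (fun _ => a)) →
      ∃ a : N, ∀ φ ∈ S, φ.Realize (fun _ => a)

end GlobalTypes

open GlobalTypes

-- An infinite independent set contains a sequence `a` such that fewer than k elements cannot have k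
-- of its terms in their closure (Steinitz exchange). A term at which a formula of `p` with n
-- parameters fails lies in the closure of those parameters, so it fails at no more than n terms.
-- Thus `p` is the average type of `a` with a uniform bound (`IsAverage`), and everything except
-- strong regularity follows from this bound.
--
-- A vote among the first 2n+1 terms decides membership in `p`, which gives definability. The bound
-- is first-order for each formula, so it passes to the limit type `q` of `a` over the monster
-- model; that limit is the unique heir. In a formula true of finitely many terms of a Morley
-- sequence of `q`, those terms can be traded, last one first, for distinct terms of `a`. A formula
-- both true and false infinitely often would then violate the bound.
--
-- Strong regularity also uses idempotence of `Cl_p`: if `z` is in the closure of `T`, then an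
-- element outside that closure is outside the closure of `T ∪ {z}`. `inType_regularityFormula`
-- expresses this by a single formula and moves it from `p` to `q` by the heir property.

universe w₂

namespace GlobalTypes

open FirstOrder.Language Cardinal

/-! ### Formulas with parameters. -/

section Formulas

variable {L : FirstOrder.Language.{u, v}} {N : Type w} [L.Structure N]

theorem holds_relabel {γ γ' : Type*} (φ : L.Formula (Fin 1 ⊕ γ)) (g : γ → γ') (a : N)
    (b : γ' → N) : Holds (φ.relabel (Sum.map id g)) a b ↔ Holds φ a (b ∘ g) := by
  unfold Holds
  rw [Formula.realize_relabel, Sum.elim_comp_map]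
  rfl

@[simp]
theorem holds_not {γ : Type*} (φ : L.Formula (Fin 1 ⊕ γ)) (a : N) (b : γ → N) :
    Holds (∼φ) a b ↔ ¬ Holds φ a b := Formula.realize_not

@[simp]
theorem holds_inf {γ : Type*} (φ ψ : L.Formula (Fin 1 ⊕ γ)) (a : N) (b : γ → N) :
    Holds (φ ⊓ ψ) a b ↔ Holds φ a b ∧ Holds ψ a b := Formula.realize_inf

/-- Only finitely many of the parameter variables occur in a formula. -/
theorem exists_formula_fin {γ : Type*} (φ : L.Formula (Fin 1 ⊕ γ)) :
    ∃ (n : ℕ) (ψ : L.Formula (Fin 1 ⊕ Fin n)) (g : Fin n → γ),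
      ∀ (W : Type w') [L.Structure W] (a : W) (b : γ → W), Holds ψ a (b ∘ g) ↔ Holds φ a b := by
  classical
  let S : Finset γ := φ.freeVarFinset.toRight
  let e : S ≃ Fin S.card := S.equivFin
  let f : φ.freeVarFinset → Fin 1 ⊕ Fin S.card := fun x =>
    match x with
    | ⟨Sum.inl i, _⟩ => Sum.inl i
    | ⟨Sum.inr j, h⟩ => Sum.inr (e ⟨j, Finset.mem_toRight.2 h⟩)
  refine ⟨S.card, φ.restrictFreeVar f, fun i => (e.symm i : γ), fun W _ a b => ?_⟩
  refine BoundedFormula.realize_restrictFreeVar _ ?_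
  rintro ⟨i | j, h⟩
  · rfl
  · simp [f]

end Formulas

/-! ### Calculus of complete types; limits along ultrafilters. -/

section Types

variable {L : FirstOrder.Language.{u, v}} {N : Type w} [L.Structure N]

/-- A type over `N` is realized in some elementary extension of `N`. (The two clauses differ only
in the universe of the parameter variables.) -/
theorem exists_realization (p : OneType L N) :
    ∃ (W : Type (max u v w)) (_ : L.Structure W) (j : N ↪ₑ[L] W) (x : W),
      (∀ {γ : Type w'} (φ : L.Formula (Fin 1 ⊕ γ)) (b : γ → N),
        InType p φ b ↔ Holds φ x (j ∘ b)) ∧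
      ∀ {γ : Type w₂} (φ : L.Formula (Fin 1 ⊕ γ)) (b : γ → N),
        InType p φ b ↔ Holds φ x (j ∘ b) := by
  obtain ⟨W, x, hx⟩ := (L.elementaryDiagram N).exists_modelType_is_realized_in p
  let : L.Structure W := (L.lhomWithConstants N).reduct W
  have : (L.lhomWithConstants N).IsExpansionOn W := LHom.isExpansionOn_reduct _ _
  refine ⟨W, inferInstance, ElementaryEmbedding.ofModelsElementaryDiagram L N W, x 0, ?_, ?_⟩
  all_goals
    intro γ φ b
    rw [InType, ← hx, Theory.CompleteType.formula_mem_typeOf]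
    unfold inst Holds Formula.Realize
    rw [BoundedFormula.realize_subst]
    change ((L.lhomWithConstants N).onFormula φ).Realize _ ↔ φ.Realize _
    rw [LHom.realize_onFormula]
    refine iff_of_eq (congrArg _ ?_)
    funext i
    cases i with
    | inl i => simp [Subsingleton.elim i 0]
    | inr j => simp; rfl

@[simp]
theorem inType_not (p : OneType L N) {γ : Type w'} (φ : L.Formula (Fin 1 ⊕ γ)) (b : γ → N) :
    InType p (∼φ) b ↔ ¬ InType p φ b := by
  obtain ⟨W, _, j, x, h, -⟩ := exists_realization.{u, v, w, w', w'} p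
  rw [h, h, holds_not]

/-- The implication, quantified over `x`, is a first-order statement about the parameters, so it
survives in an elementary extension realizing `p`. -/
theorem InType.mono {p : OneType L N} {γ : Type w'} {γ' : Type w₂} {φ : L.Formula (Fin 1 ⊕ γ)}
    {b : γ → N} {ψ : L.Formula (Fin 1 ⊕ γ')} {b' : γ' → N} (hφ : InType p φ b)
    (h : ∀ a, Holds φ a b → Holds ψ a b') : InType p ψ b' := by
  obtain ⟨W, _, j, x, hx, hx'⟩ := exists_realization.{u, v, w, w', w₂} p
  rw [hx] at hφ
  rw [hx']
  let χ : L.Formula (γ ⊕ γ') := Formula.iAlls (Fin 1)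
    ((φ.relabel (Sum.elim Sum.inr (fun i => Sum.inl (Sum.inl i)))).imp
      (ψ.relabel (Sum.elim Sum.inr (fun i => Sum.inl (Sum.inr i)))))
  have key : χ.Realize (Sum.elim b b') := by
    simp only [χ, Formula.realize_iAlls, Formula.realize_imp, Formula.realize_relabel]
    intro i h1
    have e : i = fun _ => i 0 := funext fun k => by rw [Subsingleton.elim k 0]
    rw [e] at h1 ⊢
    have h2 := h (i 0)
    unfold Holds at h2
    convert h2 ?_ using 1
    · funext k
      rcases k with k | k <;> rfl
    · convert h1 using 1
      funext k
      rcases k with k | k <;> rfl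
  rw [← j.map_formula] at key
  simp only [χ, Formula.realize_iAlls, Formula.realize_imp, Formula.realize_relabel] at key
  have := key (fun _ => x)
  unfold Holds at hφ ⊢
  convert this ?_ using 1
  · funext k
    rcases k with k | k <;> simp
  · convert hφ using 1
    funext k
    rcases k with k | k <;> simp

theorem inType_congr {p : OneType L N} {γ : Type w'} {γ' : Type w₂} {φ : L.Formula (Fin 1 ⊕ γ)}
    {b : γ → N} {ψ : L.Formula (Fin 1 ⊕ γ')} {b' : γ' → N}
    (h : ∀ a, Holds φ a b ↔ Holds ψ a b') : InType p φ b ↔ InType p ψ b' :=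
  ⟨fun hφ => hφ.mono fun a => (h a).1, fun hψ => hψ.mono fun a => (h a).2⟩

theorem inType_relabel (p : OneType L N) {γ : Type w'} {γ' : Type w₂}
    (φ : L.Formula (Fin 1 ⊕ γ)) (g : γ → γ') (b : γ' → N) :
    InType p (φ.relabel (Sum.map id g)) b ↔ InType p φ (b ∘ g) :=
  inType_congr fun a => holds_relabel φ g a b

theorem InType.exists_holds {p : OneType L N} {γ : Type w'} {φ : L.Formula (Fin 1 ⊕ γ)}
    {b : γ → N} (hφ : InType p φ b) : ∃ a, Holds φ a b := by
  by_contra! h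
  exact (inType_not p φ b).1 (hφ.mono fun a ha => absurd ha (h a)) hφ

theorem Realizes.holds {p : OneType L N} {B : Set N} {a : N} (h : Realizes p B a)
    {γ : Type w'} (φ : L.Formula (Fin 1 ⊕ γ)) (b : γ → N) (hb : ∀ i, b i ∈ B)
    (hφ : InType p φ b) : Holds φ a b := by
  obtain ⟨n, ψ, g, hψ⟩ := exists_formula_fin φ
  exact (hψ N a b).1 (h n ψ _ (fun i => hb _) (hφ.mono fun c hc => (hψ N c b).2 hc))

/-- Every formula with constants from `N` is of the form `φ(x, b)`, up to equivalence. -/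
theorem exists_inst_iff {N : Type w} (χ : L[[N]].Formula (Fin 1)) :
    ∃ (n : ℕ) (φ : L.Formula (Fin 1 ⊕ Fin n)) (b : Fin n → N),
      ∀ (W : Type w₂) [L.Structure W] [L[[N]].Structure W]
        [(L.lhomWithConstants N).IsExpansionOn W] (x : W),
        (inst φ b).Realize (fun _ => x) ↔ χ.Realize (fun _ => x) := by
  let φ₀ : L.Formula (Fin 1 ⊕ N) := Formula.relabel Sum.swap (BoundedFormula.constantsVarsEquiv χ)
  obtain ⟨n, φ, g, h⟩ := exists_formula_fin φ₀
  refine ⟨n, φ, g, fun W _ _ _ x => ?_⟩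
  have h1 := h W x (fun c => (L.con c : W))
  have h2 : Holds φ₀ x (fun c => (L.con c : W)) ↔ χ.Realize (fun _ => x) := by
    unfold Holds
    rw [Formula.realize_relabel]
    have := BoundedFormula.realize_constantsVarsEquiv (φ := χ) (v := fun _ => x) (M := W)
      (xs := default)
    rw [Formula.Realize, Formula.Realize, ← this]
    congr! 1
    funext k
    rcases k with k | k <;> rfl
  rw [← h2, ← h1]
  unfold inst Holds Formula.Realize
  rw [BoundedFormula.realize_subst]
  change ((L.lhomWithConstants N).onFormula φ).Realize _ ↔ φ.Realize _
  rw [LHom.realize_onFormula]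
  refine iff_of_eq (congrArg _ ?_)
  funext i
  cases i with
  | inl i => simp
  | inr j => simp

theorem oneType_ext {p q : OneType L N}
    (h : ∀ (n : ℕ) (φ : L.Formula (Fin 1 ⊕ Fin n)) (b : Fin n → N),
      InType p φ b ↔ InType q φ b) : p = q := by
  refine SetLike.ext fun σ => ?_
  obtain ⟨χ, rfl⟩ := Formula.equivSentence.surjective σ
  obtain ⟨n, φ, b, hφ⟩ := exists_inst_iff.{u, v, w, max u v w} χ
  have key : ∀ r : OneType L N, Formula.equivSentence χ ∈ r ↔ InType r φ b := by
    intro r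
    obtain ⟨W, x, hx⟩ := (L.elementaryDiagram N).exists_modelType_is_realized_in r
    let : L.Structure W := (L.lhomWithConstants N).reduct W
    have : (L.lhomWithConstants N).IsExpansionOn W := LHom.isExpansionOn_reduct _ _
    have e : x = fun _ => x 0 := funext fun k => by rw [Subsingleton.elim k 0]
    rw [InType, ← hx, Theory.CompleteType.formula_mem_typeOf,
      Theory.CompleteType.formula_mem_typeOf, e]
    exact (hφ W (x 0)).symm
  rw [key, key, h]

/-- The limit type of a sequence along an ultrafilter. -/
theorem exists_limit_type {ι : Type w₂} (U : Ultrafilter ι) (a : ι → N) :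
    ∃ q : OneType L N, ∀ {γ : Type w'} (φ : L.Formula (Fin 1 ⊕ γ)) (b : γ → N),
      InType q φ b ↔ ∀ᶠ i in U, Holds φ (a i) b := by
  obtain ⟨i₀⟩ : Nonempty ι := Filter.nonempty_of_neBot (U : Filter ι)
  have : Nonempty N := ⟨a i₀⟩
  let W := (U : Filter ι).Product (fun _ => N)
  let : L[[N]].Structure W := Ultraproduct.structure
  have : Nonempty W := Ultraproduct.Product.instNonempty
  have hW : W ⊨ L.elementaryDiagram N := by
    refine ⟨fun σ hσ => (Ultraproduct.sentence_realize σ).2 (Filter.Eventually.of_forall ?_)⟩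
    exact fun _ => hσ
  let x : W := ((a : ι → N) : (U : Filter ι).Product (fun _ => N))
  refine ⟨(L.elementaryDiagram N).typeOf (M := W) (fun _ : Fin 1 => x), ?_⟩
  intro γ φ b
  rw [InType, Theory.CompleteType.formula_mem_typeOf]
  refine (Ultraproduct.realize_formula_cast (inst φ b) (fun _ : Fin 1 => a)).trans ?_
  exact Filter.eventually_congr (Filter.Eventually.of_forall fun i => realize_inst φ b (a i))

end Types

/-! ### Exchange and independent sequences. -/

section Pregeometry

variable {P : Type w} {cl : Set P → Set P}

theorem IsPregeometry.cl_subset_cl (h : IsPregeometry cl) {A B : Set P} (hAB : A ⊆ cl B) :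
    cl A ⊆ cl B :=
  (h.mono _ _ hAB).trans (h.transitivity B).subset

/-- A set which is independent over `X` and contained in `cl (X ∪ T)` has at most `|T|`
elements. -/
theorem IsPregeometry.card_le_card (h : IsPregeometry cl) (T : Finset P) :
    ∀ (X : Set P) (J : Finset P), (∀ j ∈ J, j ∉ cl (X ∪ (J \ {j} : Set P))) →
      (J : Set P) ⊆ cl (X ∪ T) → J.card ≤ T.card := by
  classical
  induction T using Finset.induction_on with
  | empty =>
    intro X J hJ hsub
    have : J = ∅ := Finset.eq_empty_of_forall_notMem fun j hj =>
      hJ j hj (h.mono _ _ (by simp) (hsub hj))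
    simp [this]
  | insert b T hb ih =>
    intro X J hJ hsub
    by_cases hT : (J : Set P) ⊆ cl (X ∪ T)
    · exact (ih X J hJ hT).trans (Finset.card_le_card (Finset.subset_insert b T))
    obtain ⟨j, hj, hjT⟩ := Set.not_subset.1 hT
    -- Steinitz exchange: `j` takes the place of `b` and then joins the base set `X`, leaving `J`
    -- without `j` to be compared with `T`.
    have hb' : b ∈ cl ((X ∪ T) ∪ {j}) := by
      refine h.exchange _ _ _ (h.mono _ _ ?_ (hsub hj)) hjT
      intro x hx
      rw [Finset.coe_insert] at hx
      simp only [Set.mem_union, Set.mem_insert_iff, Set.mem_singleton_iff] at hx ⊢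
      tauto
    have := ih (X ∪ {j}) (J.erase j) ?_ ?_
    · rw [Finset.card_erase_of_mem hj] at this
      rw [Finset.card_insert_of_notMem hb]
      omega
    · intro i hi hcl
      rw [Finset.mem_erase] at hi
      refine hJ i hi.2 (h.mono _ _ ?_ hcl)
      rintro x ((hx | rfl) | ⟨hx, hxi⟩)
      · exact Or.inl hx
      · exact Or.inr ⟨hj, fun e => hi.1 e.symm⟩
      · exact Or.inr ⟨(Finset.mem_erase.1 hx).2, hxi⟩
    · refine (Finset.coe_subset.2 (Finset.erase_subset j J)).trans (hsub.trans ?_)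
      refine h.cl_subset_cl ?_
      intro x hx
      rw [Finset.coe_insert] at hx
      rcases hx with hx | rfl | hx
      · exact h.subset_cl _ (Or.inl (Or.inl hx))
      · refine h.mono _ _ ?_ hb'
        intro y hy
        simp only [Set.mem_union, Set.mem_singleton_iff] at hy ⊢
        tauto
      · exact h.subset_cl _ (Or.inr hx)

/-- In an infinite-dimensional pregeometry there is a sequence of which at most `n` members lie
in the closure of any set of `n` elements. -/
theorem IsPregeometry.exists_sequence (h : IsPregeometry cl) (hd : IsInfiniteDimensional cl) :
    ∃ a : ℕ → P, Function.Injective a ∧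
      ∀ (T : Finset P) (s : Finset ℕ), T.card < s.card → ∃ i ∈ s, a i ∉ cl T := by
  classical
  obtain ⟨I, hI, hind⟩ := hd
  refine ⟨fun i => (hI.natEmbedding I i : P),
    Subtype.val_injective.comp (hI.natEmbedding I).injective, fun T s hs => ?_⟩
  by_contra! hcl
  let e : ℕ ↪ P := (hI.natEmbedding I).trans (Function.Embedding.subtype _)
  have := h.card_le_card T ∅ (s.map e) ?_ ?_
  · rw [Finset.card_map] at this
    omega
  · intro j hj hj'
    have hsub : ((s.map e : Finset P) : Set P) ⊆ I := by
      intro x hx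
      obtain ⟨i, -, rfl⟩ := Finset.mem_map.1 hx
      exact (hI.natEmbedding I i).2
    refine hind j (hsub hj) (h.mono _ _ ?_ hj')
    rw [Set.empty_union]
    exact Set.sdiff_subset_sdiff_left hsub
  · intro x hx
    obtain ⟨i, hi, rfl⟩ := Finset.mem_map.1 hx
    rw [Set.empty_union]
    exact hcl i hi

end Pregeometry

/-! ### One step of the closure operator. -/

section ClOp

variable {L : FirstOrder.Language.{u, v}} {N : Type w} [L.Structure N] {p : OneType L N}

theorem clOp_subset_ClOp (X : Set N) : clOp p X ⊆ ClOp p X :=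
  Set.subset_iUnion (fun n : ℕ => (clOp p)^[n] X) 1

theorem mem_clOp_of_inType {γ : Type w'} {φ : L.Formula (Fin 1 ⊕ γ)} {b : γ → N} {X : Set N}
    (hb : ∀ i, b i ∈ X) (hφ : InType p φ b) {a : N} (ha : ¬ Holds φ a b) : a ∈ clOp p X :=
  fun hr => ha (hr.holds φ b hb hφ)

end ClOp

/-! ### Average types: definability and invariance. -/

section Average

variable {L : FirstOrder.Language.{u, v}} {N : Type w} [L.Structure N]

/-- `p` is the average type of the sequence `a`, in the strong sense that a formula in `p` with
`n` parameters fails in at most `n` members of the sequence. -/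
def IsAverage (p : OneType L N) (a : ℕ → N) : Prop :=
  ∀ (n : ℕ) (φ : L.Formula (Fin 1 ⊕ Fin n)) (b : Fin n → N), InType p φ b →
    ∀ s : Finset ℕ, n < s.card → ∃ i ∈ s, Holds φ (a i) b

theorem isAverage_of_notMem_closure {p : OneType L N} {a : ℕ → N}
    (ha : ∀ (T : Finset N) (s : Finset ℕ), T.card < s.card → ∃ i ∈ s, a i ∉ ClOp p T) :
    IsAverage p a := by
  classical
  intro n φ b hφ s hs
  obtain ⟨i, hi, hcl⟩ := ha (Finset.univ.image b) s
    ((Finset.card_image_le.trans (by simp)).trans_lt hs)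
  refine ⟨i, hi, ?_⟩
  by_contra hno
  exact hcl (clOp_subset_ClOp _ (mem_clOp_of_inType (fun i => by simp) hφ hno))

namespace IsAverage

variable {p : OneType L N} {a : ℕ → N}

theorem exists_holds (h : IsAverage p a) {γ : Type w'} [Fintype γ] {φ : L.Formula (Fin 1 ⊕ γ)}
    {b : γ → N} (hφ : InType p φ b) {s : Finset ℕ} (hs : Fintype.card γ < s.card) :
    ∃ i ∈ s, Holds φ (a i) b := by
  let e := Fintype.equivFin γ
  have hb : (b ∘ e.symm) ∘ e = b := by ext; simp
  obtain ⟨i, hi, h'⟩ := h _ (φ.relabel (Sum.map id e)) (b ∘ e.symm)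
    ((inType_relabel _ _ _ _).2 (by rwa [hb])) s hs
  exact ⟨i, hi, by rwa [holds_relabel, hb] at h'⟩

theorem inType_of_forall_holds (h : IsAverage p a) {γ : Type w'} [Fintype γ]
    {φ : L.Formula (Fin 1 ⊕ γ)} {b : γ → N} {s : Finset ℕ} (hs : Fintype.card γ < s.card)
    (hφ : ∀ i ∈ s, Holds φ (a i) b) : InType p φ b := by
  by_contra hno
  obtain ⟨i, hi, hi'⟩ := h.exists_holds ((inType_not p φ b).2 hno) hs
  exact (holds_not _ _ _).1 hi' (hφ i hi)

theorem eventually (h : IsAverage p a) {γ : Type w'} {φ : L.Formula (Fin 1 ⊕ γ)}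
    {b : γ → N} (hφ : InType p φ b) : ∀ᶠ i in Filter.cofinite, Holds φ (a i) b := by
  obtain ⟨n, ψ, g, hψ⟩ := exists_formula_fin φ
  by_contra hinf
  obtain ⟨s, hs, hcard⟩ := Set.Infinite.exists_subset_card_eq (s := {i | ¬ Holds φ (a i) b})
    hinf (n + 1)
  obtain ⟨i, hi, hi'⟩ := h n ψ (b ∘ g) (hφ.mono fun c hc => (hψ N c b).2 hc) s (by omega)
  exact hs hi ((hψ N _ b).1 hi')

theorem inType_iff_eventually (h : IsAverage p a) {γ : Type w'} {φ : L.Formula (Fin 1 ⊕ γ)}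
    {b : γ → N} : InType p φ b ↔ ∀ᶠ i in Filter.cofinite, Holds φ (a i) b := by
  refine ⟨h.eventually, fun hev => ?_⟩
  by_contra hno
  obtain ⟨i, h1, h2⟩ := (hev.and (h.eventually ((inType_not p φ b).2 hno))).exists
  exact (holds_not _ _ _).1 h2 h1

end IsAverage

/-- The defining formula of `φ` for an average type: "more than half of the first `2 * n + 1`
members of the sequence satisfy `φ`", where `n` is the number of parameters. -/
noncomputable def majority {γ : Type w'} [Fintype γ] (φ : L.Formula (Fin 1 ⊕ γ)) :
    L.Formula (γ ⊕ Fin (2 * Fintype.card γ + 1)) :=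
  Formula.iSup fun s : {s : Finset (Fin (2 * Fintype.card γ + 1)) // Fintype.card γ < s.card} =>
    Formula.iInf fun i : s.1 => φ.relabel (Sum.elim (fun _ => Sum.inr i.1) Sum.inl)

theorem realize_majority_iff {γ : Type w'} [Fintype γ] (φ : L.Formula (Fin 1 ⊕ γ)) (b : γ → N)
    (c : Fin (2 * Fintype.card γ + 1) → N) :
    (majority φ).Realize (Sum.elim b c) ↔
      ∃ s : Finset (Fin (2 * Fintype.card γ + 1)), Fintype.card γ < s.card ∧
        ∀ i ∈ s, Holds φ (c i) b := by
  have key : ∀ i, Sum.elim b c ∘ Sum.elim (fun _ : Fin 1 => Sum.inr i) Sum.inl =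
      Sum.elim (fun _ => c i) b := by
    intro i
    funext k
    rcases k with k | k <;> rfl
  simp only [majority, Formula.realize_iSup, Formula.realize_iInf, Formula.realize_relabel, key,
    Subtype.exists, Subtype.forall, exists_prop]
  rfl

theorem IsAverage.realize_majority {p : OneType L N} {a : ℕ → N} (h : IsAverage p a)
    {γ : Type w'} [Fintype γ] (φ : L.Formula (Fin 1 ⊕ γ)) (b : γ → N) :
    (majority φ).Realize (Sum.elim b fun i => a i) ↔ InType p φ b := by
  classical
  rw [realize_majority_iff]
  constructor
  · rintro ⟨s, hs, hφ⟩
    refine h.inType_of_forall_holds (s := s.map Fin.valEmbedding) (by rwa [Finset.card_map]) ?_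
    intro i hi
    obtain ⟨j, hj, rfl⟩ := Finset.mem_map.1 hi
    exact hφ j hj
  -- If at most n of the 2n+1 terms satisfied `φ`, at least n+1 would fail it, one more than the
  -- bound allows.
  · intro hφ
    refine ⟨Finset.univ.filter fun i => Holds φ (a i) b, ?_, by simp⟩
    by_contra! hle
    have hcard := Finset.card_filter_add_card_filter_not (s := Finset.univ)
      (fun i : Fin (2 * Fintype.card γ + 1) => Holds φ (a i) b)
    rw [Finset.card_univ, Fintype.card_fin] at hcard
    obtain ⟨i, hi, hi'⟩ := h.exists_holds hφ (s := (Finset.univ.filter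
      fun i : Fin (2 * Fintype.card γ + 1) => ¬ Holds φ (a i) b).map Fin.valEmbedding)
      (by rw [Finset.card_map]; omega)
    obtain ⟨j, hj, rfl⟩ := Finset.mem_map.1 hi
    exact (Finset.mem_filter.1 hj).2 hi'

theorem IsAverage.isDefinableType {p : OneType L N} {a : ℕ → N} (h : IsAverage p a) :
    IsDefinableType p := by
  intro n φ
  rw [Set.definable_iff_exists_formula_sum]
  refine ⟨Formula.relabel (Sum.elim Sum.inr
    fun i : Fin (2 * Fintype.card (Fin n) + 1) => Sum.inl ⟨a i, trivial⟩) (majority φ), ?_⟩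
  ext b
  rw [Set.mem_ofPred_eq, Set.mem_ofPred_eq, ← h.realize_majority, Formula.realize_relabel]
  refine iff_of_eq (congrArg _ ?_)
  funext k
  rcases k with k | k <;> rfl

theorem IsAverage.isNonAlgebraic {p : OneType L N} {a : ℕ → N} (h : IsAverage p a)
    (ha : Function.Injective a) : IsNonAlgebraic p := by
  intro n φ b hφ hfin
  have hev := h.eventually hφ
  have h2 : {i | Holds φ (a i) b}.Finite := hfin.preimage ha.injOn
  have h3 : (∅ : Set ℕ) ∈ Filter.cofinite := by
    filter_upwards [hev, h2.compl_mem_cofinite] with i h1 h2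
    exact h2 h1
  simp at h3

/-- Membership of `φ(x, b)` depends only on which `φ(a i, b)` hold, and these are recorded in the
type of `b` over `A`. -/
theorem IsAverage.isInvariant {p : OneType L N} {a : ℕ → N} (h : IsAverage p a) {A : Set N}
    (hA : ∀ i, a i ∈ A) : IsInvariant A p := by
  intro n φ b b' hb
  rw [h.inType_iff_eventually, h.inType_iff_eventually]
  refine Filter.eventually_congr (Filter.Eventually.of_forall fun i => ?_)
  let ψ : L[[A]].Formula (Fin n) :=
    BoundedFormula.constantsVarsEquiv.symm
      (Formula.relabel (Sum.map (fun _ : Fin 1 => (⟨a i, hA i⟩ : A)) id) φ)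
  have key : ∀ c : Fin n → N, ψ.Realize c ↔ Holds φ (a i) c := by
    intro c
    have := BoundedFormula.realize_constantsVarsEquiv (φ := ψ) (v := c) (M := N)
      (xs := default)
    rw [Formula.Realize, ← this]
    simp only [ψ, Equiv.apply_symm_apply]
    change Formula.Realize _ _ ↔ _
    rw [Formula.realize_relabel]
    refine iff_of_eq (congrArg _ ?_)
    funext k
    rcases k with k | k <;> rfl
  rw [← key, ← key]
  exact hb ψ

end Average

/-! ### From `M` to the monster model: the unique heir. -/

section Transfer

variable {L : FirstOrder.Language.{u, v}} {N : Type w} [L.Structure N]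

/-- The formula `⋀ i ∈ s, φ(x i, y)`. -/
noncomputable def conj {ι : Type*} {γ : Type*} (φ : L.Formula (Fin 1 ⊕ γ)) (s : Finset ι) :
    L.Formula (ι ⊕ γ) :=
  Formula.iInf fun i : s => φ.relabel (Sum.map (fun _ => i.1) id)

@[simp]
theorem realize_conj {ι : Type*} {γ : Type*} (φ : L.Formula (Fin 1 ⊕ γ)) (s : Finset ι)
    (f : ι → N) (b : γ → N) :
    (conj φ s).Realize (Sum.elim f b) ↔ ∀ i ∈ s, Holds φ (f i) b := by
  simp only [conj, Formula.realize_iInf, Formula.realize_relabel, Sum.elim_comp_map,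
    Subtype.forall]
  rfl

variable {M : L.ElementarySubstructure N}

theorem exists_realize_of_elementary {α β : Type*} [Finite β] (χ : L.Formula (α ⊕ β))
    (x : α → M) {y : β → N} (h : χ.Realize (Sum.elim (fun i => (x i : N)) y)) :
    ∃ y' : β → M, χ.Realize (Sum.elim x y') := by
  rw [← Formula.realize_iExs, ← M.subtype.map_formula, Formula.realize_iExs]
  exact ⟨y, h⟩

/-- An average type over `M` extends to an average type of the same sequence. -/
theorem IsAverage.exists_extension {p : OneType L M} {a : ℕ → M} (h : IsAverage p a) :
    ∃ q : OneType L N, IsAverage q (fun i => (a i : N)) := by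
  obtain ⟨q, hq⟩ := exists_limit_type (L := L) (Filter.hyperfilter ℕ) (fun i => (a i : N))
  refine ⟨q, fun n φ b hφ s hs => ?_⟩
  by_contra! hno
  have hinf : {i | Holds φ (a i : N) b}.Infinite :=
    Filter.frequently_cofinite_iff_infinite.1
      (((hq φ b).1 hφ).frequently.filter_mono Filter.hyperfilter_le_cofinite)
  obtain ⟨s', hs', hcard⟩ := hinf.exists_subset_card_eq (n + 1)
  -- A violation of the bound involves finitely many terms of `a`, all in `M`, so parameters in `M`
  -- violate it too: truth on the n+1 terms of `s'` puts the formula in `p`, yet it fails on `s`.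
  obtain ⟨y, hy⟩ := exists_realize_of_elementary (conj φ s' ⊓ conj (∼φ) s) a (y := b) (by
    rw [Formula.realize_inf, realize_conj, realize_conj]
    exact ⟨fun i hi => hs' hi, fun i hi => (holds_not _ _ _).2 (hno i hi)⟩)
  rw [Formula.realize_inf, realize_conj, realize_conj] at hy
  obtain ⟨i, hi, hi'⟩ := h n φ y
    (h.inType_of_forall_holds (s := s') (by simp [hcard]) hy.1) s hs
  exact (holds_not _ _ _).1 (hy.2 i hi) hi'

/-- Truth at one more term than there are parameters certifies membership in `p`, and elementarity
finds parameters in `M` with the same certificate. -/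
theorem IsAverage.exists_inType {p : OneType L M} {a : ℕ → M} (h : IsAverage p a)
    {q : OneType L N} (hq : IsAverage q (fun i => (a i : N))) {γ δ : Type*} [Fintype γ]
    [Fintype δ] {φ : L.Formula (Fin 1 ⊕ (γ ⊕ δ))} {c : γ → N} {m : δ → M}
    (hφ : InType q φ (Sum.elim c fun i => (m i : N))) :
    ∃ b : γ → M, InType p φ (Sum.elim b m) := by
  have hinf : {i | Holds φ (a i : N) (Sum.elim c fun i => (m i : N))}.Infinite :=
    Filter.frequently_cofinite_iff_infinite.1 (hq.eventually hφ).frequently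
  obtain ⟨s, hs, hcard⟩ := hinf.exists_subset_card_eq (Fintype.card (γ ⊕ δ) + 1)
  have key : ∀ {W : Type w} [L.Structure W] (f : ℕ → W) (d : δ → W) (y : γ → W),
      ((conj φ s).relabel (Sum.elim (fun i => Sum.inl (Sum.inl i))
        (Sum.elim Sum.inr fun i => Sum.inl (Sum.inr i))) : L.Formula ((ℕ ⊕ δ) ⊕ γ)).Realize
        (Sum.elim (Sum.elim f d) y) ↔ ∀ i ∈ s, Holds φ (f i) (Sum.elim y d) := by
    intro W _ f d y
    rw [Formula.realize_relabel, ← realize_conj]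
    refine iff_of_eq (congrArg _ ?_)
    funext k
    rcases k with k | k | k <;> rfl
  obtain ⟨y, hy⟩ := exists_realize_of_elementary _ (Sum.elim a m) (y := c) (by
    have := (key (fun i => (a i : N)) (fun i => (m i : N)) c).2 fun i hi => hs hi
    convert this using 2
    funext k
    rcases k with k | k <;> rfl)
  exact ⟨y, h.inType_of_forall_holds (by omega) ((key a m y).1 hy)⟩

theorem IsAverage.isHeir {p : OneType L M} {a : ℕ → M} (h : IsAverage p a)
    {q : OneType L N} (hq : IsAverage q (fun i => (a i : N))) : IsHeir p q := by
  refine ⟨fun n φ m hφ => ?_, fun n k φ c m hφ => h.exists_inType hq hφ⟩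
  rw [hq.inType_iff_eventually]
  filter_upwards [h.eventually hφ] with i hi
  unfold Holds at hi ⊢
  rw [← M.subtype.map_formula] at hi
  convert hi using 1
  funext k
  rcases k with k | k <;> rfl

/-- If `q'` contained a formula that `q` omits, it would fail at n+1 terms of `a`. Since these terms
are in `M`, the heir property would put such a formula into `p`, against the bound. -/
theorem IsAverage.eq_of_isHeir {p : OneType L M} {a : ℕ → M} (h : IsAverage p a)
    {q : OneType L N} (hq : IsAverage q (fun i => (a i : N))) {q' : OneType L N}
    (hq' : IsHeir p q') : q' = q := by
  have key : ∀ (n : ℕ) (φ : L.Formula (Fin 1 ⊕ Fin n)) (c : Fin n → N),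
      InType q' φ c → InType q φ c := by
    intro n φ c hφ
    by_contra hno
    have hinf : {i | Holds (∼φ) (a i : N) c}.Infinite :=
      Filter.frequently_cofinite_iff_infinite.1
        (hq.eventually ((inType_not q φ c).2 hno)).frequently
    obtain ⟨s, hs, hcard⟩ := hinf.exists_subset_card_eq (n + 1)
    let e := s.equivFinOfCardEq hcard
    let m : Fin (n + 1) → M := fun i => a (e.symm i)
    let χ : L.Formula (Fin 1 ⊕ (Fin n ⊕ Fin (n + 1))) :=
      φ.relabel (Sum.map id Sum.inl) ⊓
        (conj (∼φ) Finset.univ).relabel (fun k => Sum.inr k.swap)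
    have hχ : ∀ {W : Type w} [L.Structure W] (x : W) (y : Fin n → W) (d : Fin (n + 1) → W),
        Holds χ x (Sum.elim y d) ↔ Holds φ x y ∧ ∀ i, ¬ Holds φ (d i) y := by
      intro W _ x y d
      rw [holds_inf, holds_relabel]
      refine and_congr (by rw [Sum.elim_comp_inl]) ?_
      rw [Holds, Formula.realize_relabel]
      have := realize_conj (∼φ) Finset.univ d y
      simp only [Finset.mem_univ, true_imp_iff, holds_not] at this
      rw [← this]
      refine iff_of_eq (congrArg _ ?_)
      funext k
      rcases k with k | k <;> rfl
    obtain ⟨y, hy⟩ := hq'.2 n (n + 1) χ c m (hφ.mono fun x hx => (hχ _ _ _).2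
      ⟨hx, fun i => (holds_not _ _ _).1 (hs (e.symm i).2)⟩)
    obtain ⟨x, hx⟩ := hy.exists_holds
    obtain ⟨i, hi, hi'⟩ := h n φ y (hy.mono fun x hx => ((hχ _ _ _).1 hx).1) s (by omega)
    refine ((hχ _ _ _).1 hx).2 (e ⟨i, hi⟩) ?_
    simpa [m] using hi'
  refine oneType_ext fun n φ c => ⟨key n φ c, fun hφ => ?_⟩
  by_contra hno
  exact (inType_not q φ c).1 (key n _ c ((inType_not q' φ c).2 hno)) hφ

end Transfer

/-! ### Morley sequences and generic stability. -/

section Morley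

variable {L : FirstOrder.Language.{u, v}} {N : Type w} [L.Structure N]

/-- A formula true of finitely many members of a Morley sequence of the average type of `a` is true
of distinct members of `a`. -/
theorem IsAverage.exists_realize_of_isMorley {q : OneType L N} {a : ℕ → N} (h : IsAverage q a)
    {A : Set N} (hA : ∀ i, a i ∈ A) {ι : Type w} [LinearOrder ι] {b : ι → N}
    (hb : IsMorley A q b) (ψ : L.Formula ι) (t : Finset ι) :
    ∀ (f : ι → N) (F : Finset ℕ), (∀ i ∈ t, f i = b i) → (∀ i ∉ t, f i ∈ A) → ψ.Realize f →
      ∃ σ : ι → ℕ, Set.InjOn σ t ∧ (∀ i ∈ t, σ i ∉ F) ∧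
        ψ.Realize fun i => if i ∈ t then a (σ i) else f i := by
  induction t using Finset.induction_on_max with
  | empty =>
    intro f F _ _ hψ
    exact ⟨fun _ => 0, by simp, by simp, by simpa using hψ⟩
  | insert j t hj ih =>
    intro f F hfb hfA hψ
    have hjt : j ∉ t := fun hjt => lt_irrefl _ (hj j hjt)
    let φ : L.Formula (Fin 1 ⊕ ι) :=
      ψ.relabel (fun i => if i = j then Sum.inl 0 else Sum.inr i)
    let g := Function.update f j (a 0)
    have hφ : ∀ x, Holds φ x g ↔ ψ.Realize (Function.update f j x) := by
      intro x
      rw [Holds, Formula.realize_relabel]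
      refine iff_of_eq (congrArg _ ?_)
      funext k
      by_cases hk : k = j
      · rw [Function.comp_apply, if_pos hk, hk, Function.update_self]
        rfl
      · rw [Function.comp_apply, if_neg hk, Function.update_of_ne hk]
        exact Function.update_of_ne hk _ _
    have hin : InType q φ g := by
      by_contra hno
      refine (holds_not _ _ _).1 ((hb j).holds _ g ?_ ((inType_not q φ g).2 hno)) ?_
      · intro i
        by_cases hi : i = j
        · subst hi
          simpa [g] using Or.inl (hA 0)
        · simp only [g, Function.update_of_ne hi]
          by_cases hit : i ∈ t
          · exact Or.inr ⟨i, hj i hit, (hfb i (Finset.mem_insert_of_mem hit)).symm⟩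
          · exact Or.inl (hfA i (by simp [hi, hit]))
      · rw [hφ, ← hfb j (Finset.mem_insert_self j t), Function.update_eq_self]
        exact hψ
    obtain ⟨i, hi, hiF⟩ := ((h.eventually hin).and F.finite_toSet.compl_mem_cofinite).exists
    -- The largest index `j` is now filled by a term from `A`; forbidding `i` from here on keeps `σ`
    -- injective.
    obtain ⟨σ, hσ, hσF, hσψ⟩ := ih (Function.update f j (a i)) (insert i F)
      (fun k hk => by
        rw [Function.update_of_ne (hj k hk).ne]
        exact hfb k (Finset.mem_insert_of_mem hk))
      (fun k hk => by
        by_cases hkj : k = j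
        · subst hkj
          simpa using hA i
        · rw [Function.update_of_ne hkj]
          exact hfA k (by simp [hkj, hk]))
      ((hφ _).1 hi)
    have hne : ∀ k ∈ t, Function.update σ j i k = σ k := fun k hk =>
      Function.update_of_ne (hj k hk).ne _ _
    refine ⟨Function.update σ j i, ?_, ?_, ?_⟩
    · rw [Finset.coe_insert, Set.injOn_insert (by simpa using hjt)]
      refine ⟨hσ.congr fun k hk => (hne k hk).symm, ?_⟩
      rintro ⟨k, hk, hk'⟩
      rw [hne k hk, Function.update_self] at hk'
      exact hσF k hk (by simp [hk'])
    · intro k hk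
      rcases Finset.mem_insert.1 hk with rfl | hk
      · rwa [Function.update_self]
      · rw [hne k hk]
        exact fun hF => hσF k hk (Finset.mem_insert_of_mem hF)
    · convert hσψ using 1
      funext k
      by_cases hkj : k = j
      · subst hkj
        simp [hjt]
      · simp [hkj]

theorem IsAverage.finite_or_finite_compl {q : OneType L N} {a : ℕ → N} (h : IsAverage q a)
    {A : Set N} (hA : ∀ i, a i ∈ A) {ι : Type w} [LinearOrder ι] {b : ι → N}
    (hb : IsMorley A q b) {n : ℕ} (φ : L.Formula (Fin 1 ⊕ Fin n)) (c : Fin n → N) :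
    {i | Holds φ (b i) c}.Finite ∨ {i | Holds φ (b i) c}ᶜ.Finite := by
  classical
  by_contra! hinf
  obtain ⟨s, hs, hcard⟩ := hinf.1.exists_subset_card_eq (n + 1)
  obtain ⟨s', hs', hcard'⟩ := hinf.2.exists_subset_card_eq (n + 1)
  -- Quantifying out `c` is essential: it need not lie in `A`, and terms may be traded only in
  -- formulas over `A`.
  let ψ : L.Formula ι := Formula.iExs (Fin n) (conj φ s ⊓ conj (∼φ) s')
  have hψ : ∀ f : ι → N, ψ.Realize f ↔
      ∃ y : Fin n → N, (∀ i ∈ s, Holds φ (f i) y) ∧ ∀ i ∈ s', ¬ Holds φ (f i) y := by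
    intro f
    simp only [ψ, Formula.realize_iExs, Formula.realize_inf, realize_conj, holds_not]
  obtain ⟨σ, hσ, -, hσψ⟩ := h.exists_realize_of_isMorley hA hb ψ (s ∪ s')
    (fun i => if i ∈ s ∪ s' then b i else a 0) ∅ (fun i hi => if_pos hi)
    (fun i hi => by rw [if_neg hi]; exact hA 0)
    ((hψ _).2 ⟨c, fun i hi => by rw [if_pos (Finset.mem_union_left _ hi)]; exact hs hi,
      fun i hi => by rw [if_pos (Finset.mem_union_right _ hi)]; exact hs' hi⟩)
  obtain ⟨y, hy, hy'⟩ := (hψ _).1 hσψ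
  have hc : ∀ r ⊆ s ∪ s', r.card = n + 1 → n < (r.image σ).card := fun r hr hrc => by
    rw [Finset.card_image_of_injOn (hσ.mono (Finset.coe_subset.2 hr)), hrc]
    omega
  have hin : InType q φ y := by
    refine h.inType_of_forall_holds (s := s.image σ)
      (by simpa using hc s Finset.subset_union_left hcard) fun i hi => ?_
    obtain ⟨k, hk, rfl⟩ := Finset.mem_image.1 hi
    simpa [hk] using hy k hk
  obtain ⟨i, hi, hi'⟩ := h n φ y hin (s'.image σ) (hc s' Finset.subset_union_right hcard')
  obtain ⟨k, hk, rfl⟩ := Finset.mem_image.1 hi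
  exact hy' k hk (by simpa [hk] using hi')

theorem IsAverage.isGenericallyStable {q : OneType L N} {a : ℕ → N} (h : IsAverage q a)
    (ha : Function.Injective a) {κ : Cardinal.{w}} {A : Set N} (hκ : #A < κ)
    (hA : ∀ i, a i ∈ A) : IsGenericallyStable κ q :=
  ⟨h.isNonAlgebraic ha, A, hκ, h.isInvariant hA, fun _ _ _ _ hb _ φ c =>
    h.finite_or_finite_compl hA hb φ c⟩

end Morley

/-! ### Strong regularity. -/

section Regular

variable {L : FirstOrder.Language.{u, v}}

/-- The tuple `y` with the entries in `S` replaced by `z`. -/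
def replace {N : Type*} {n : ℕ} (S : Finset (Fin n)) (y : Fin n → N) (z : N) : Fin n → N :=
  fun i => if i ∈ S then z else y i

/-- The initial segments of lengths `k` and `l` of a sequence. -/
def segments {N : Type*} (a : ℕ → N) (k l : ℕ) : Fin k ⊕ Fin l → N :=
  Sum.elim (fun i => a i) (fun i => a i)

/-- The formula in `x` saying that, for every `z` with `¬ φ(z, y)`, if `θ(-, y'[z])` is in the
average type, then `θ(x, y'[z])`. -/
noncomputable def regularityFormula {n m : ℕ} (φ : L.Formula (Fin 1 ⊕ Fin n))
    (θ : L.Formula (Fin 1 ⊕ Fin m)) (S : Finset (Fin m)) {δ : Type*} :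
    L.Formula (Fin 1 ⊕ ((Fin n ⊕ Fin m) ⊕ (δ ⊕ Fin (2 * Fintype.card (Fin m) + 1)))) :=
  let r : Fin m → (Fin 1 ⊕ ((Fin n ⊕ Fin m) ⊕ (δ ⊕ Fin (2 * Fintype.card (Fin m) + 1)))) ⊕ Fin 1 :=
    replace S (fun i => Sum.inl (Sum.inr (Sum.inl (Sum.inr i)))) (Sum.inr 0)
  Formula.iAlls (Fin 1)
    (φ.relabel (Sum.elim Sum.inr (fun i => Sum.inl (Sum.inr (Sum.inl (Sum.inl i))))) ⊔
      (((majority θ).relabel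
        (Sum.elim r (fun i => Sum.inl (Sum.inr (Sum.inr (Sum.inr i)))))).imp
        (θ.relabel (Sum.elim (fun i => Sum.inl (Sum.inl i)) r))))

theorem holds_regularityFormula {N : Type w} [L.Structure N] {n m : ℕ}
    (φ : L.Formula (Fin 1 ⊕ Fin n)) (θ : L.Formula (Fin 1 ⊕ Fin m)) (S : Finset (Fin m))
    {δ : Type*} (x : N) (y : Fin n → N) (y' : Fin m → N) (d : δ → N)
    (d' : Fin (2 * Fintype.card (Fin m) + 1) → N) :
    Holds (regularityFormula φ θ S) x (Sum.elim (Sum.elim y y') (Sum.elim d d')) ↔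
      ∀ z, Holds φ z y ∨ ((majority θ).Realize (Sum.elim (replace S y' z) d') →
        Holds θ x (replace S y' z)) := by
  rw [Holds, regularityFormula, Formula.realize_iAlls]
  refine (Equiv.funUnique (Fin 1) N).forall_congr fun z => ?_
  rw [Formula.realize_sup, Formula.realize_imp, Formula.realize_relabel,
    Formula.realize_relabel, Formula.realize_relabel]
  refine or_congr (iff_of_eq (congrArg _ ?_)) (imp_congr (iff_of_eq (congrArg _ ?_))
    (iff_of_eq (congrArg _ ?_)))
  · funext k
    rcases k with k | k
    · simp [Subsingleton.elim k 0]
    · rfl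
  · funext k
    rcases k with k | k
    · by_cases hk : k ∈ S <;> simp [replace, hk]
    · rfl
  · funext k
    rcases k with k | k
    · rfl
    · by_cases hk : k ∈ S <;> simp [replace, hk]

variable {N : Type w} [L.Structure N] {M : L.ElementarySubstructure N}

theorem inType_regularityFormula {p : OneType L M} (hpre : IsPregeometry (ClOp p)) {a : ℕ → M}
    (ha : ∀ (T : Finset M) (s : Finset ℕ), T.card < s.card → ∃ i ∈ s, a i ∉ ClOp p T)
    {q : OneType L N} (hq : IsAverage q (fun i => (a i : N))) {n m : ℕ}
    {φ : L.Formula (Fin 1 ⊕ Fin n)} (θ : L.Formula (Fin 1 ⊕ Fin m)) (S : Finset (Fin m))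
    {b : Fin n → N} (hφ : InType q φ b) (b' : Fin m → N) :
    InType q (regularityFormula φ θ S (δ := Fin (2 * Fintype.card (Fin n) + 1)))
      (Sum.elim (Sum.elim b b') fun i => ((segments a _ _ i : M) : N)) := by
  classical
  have hp : IsAverage p a := isAverage_of_notMem_closure ha
  by_contra hno
  -- The majority conjunct carries the fact that `φ` with its parameters is in the type, so that it
  -- is still known after reflection to `M`.
  let χ : L.Formula (Fin 1 ⊕ ((Fin n ⊕ Fin m) ⊕
      (Fin (2 * Fintype.card (Fin n) + 1) ⊕ Fin (2 * Fintype.card (Fin m) + 1)))) :=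
    ∼(regularityFormula φ θ S) ⊓ (majority φ).relabel
      (Sum.elim (fun i => Sum.inr (Sum.inl (Sum.inl i))) (fun i => Sum.inr (Sum.inr (Sum.inl i))))
  have hχ : ∀ {W : Type w} [L.Structure W] (x : W) (y : Fin n → W) (y' : Fin m → W)
      (d : Fin (2 * Fintype.card (Fin n) + 1) → W) (d' : Fin (2 * Fintype.card (Fin m) + 1) → W),
      Holds χ x (Sum.elim (Sum.elim y y') (Sum.elim d d')) ↔
        (∃ z, ¬ Holds φ z y ∧ (majority θ).Realize (Sum.elim (replace S y' z) d') ∧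
          ¬ Holds θ x (replace S y' z)) ∧ (majority φ).Realize (Sum.elim y d) := by
    intro W _ x y y' d d'
    rw [holds_inf, holds_not, holds_regularityFormula]
    refine and_congr (by push Not; rfl) ?_
    rw [Holds, Formula.realize_relabel]
    refine iff_of_eq (congrArg _ ?_)
    funext k
    rcases k with k | k <;> rfl
  have hin : InType q χ
      (Sum.elim (Sum.elim b b') fun i => ((segments a _ _ i : M) : N)) := by
    refine ((inType_not _ _ _).2 hno).mono fun x hx => ?_
    rw [holds_inf]
    refine ⟨hx, ?_⟩
    rw [Holds, Formula.realize_relabel]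
    have := (hq.realize_majority φ b).2 hφ
    convert this using 1
    funext k
    rcases k with k | k <;> rfl
  obtain ⟨c, hc⟩ := hp.exists_inType hq hin
  obtain ⟨y, y', rfl⟩ : ∃ y y', c = Sum.elim y y' :=
    ⟨c ∘ Sum.inl, c ∘ Sum.inr, (Sum.elim_comp_inl_inr c).symm⟩
  have hy : InType p φ y := by
    obtain ⟨x, hx⟩ := hc.exists_holds
    exact (hp.realize_majority φ y).1 ((hχ _ _ _ _ _).1 hx).2
  let T : Finset M := Finset.univ.image y ∪ Finset.univ.image y' ∪
    (Finset.univ.image (fun i : Fin (2 * Fintype.card (Fin n) + 1) => a i) ∪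
      Finset.univ.image (fun i : Fin (2 * Fintype.card (Fin m) + 1) => a i))
  -- A term outside the closure of all parameters realizes `p` over them, hence satisfies `χ`. The
  -- resulting `z` is in the closure of `T` because `φ` fails at it, and the term is in the closure
  -- of `T ∪ {z}` because `θ` fails at it: a contradiction by idempotence.
  obtain ⟨i, -, hi⟩ := ha T (Finset.range (T.card + 1)) (by simp)
  have hx : Holds χ (a i) (Sum.elim (Sum.elim y y') (Sum.elim (fun i => a i) (fun i => a i))) := by
    by_contra hx
    refine hi (clOp_subset_ClOp _ (mem_clOp_of_inType ?_ hc hx))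
    rintro ((k | k) | (k | k)) <;> simp [T, segments]
  obtain ⟨⟨z, hz, hθ, hxz⟩, -⟩ := (hχ _ _ _ _ _).1 hx
  have hzT : z ∈ ClOp p T :=
    clOp_subset_ClOp _ (mem_clOp_of_inType (fun k => by simp [T]) hy hz)
  refine hi (hpre.cl_subset_cl (A := T ∪ {z}) ?_ (clOp_subset_ClOp _
    (mem_clOp_of_inType ?_ ((hp.realize_majority θ _).1 hθ) hxz)))
  · exact Set.union_subset (hpre.subset_cl _) (Set.singleton_subset_iff.2 hzT)
  · intro k
    by_cases hk : k ∈ S <;> simp [replace, hk, T]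

/-- If `x` fails `φ(x, b)` in `q` over `B`, the regularity formula for `φ` and `θ` has parameters in
`B` and, specialized to `z = x`, implies `θ(-, c)`. -/
theorem isStronglyRegular_of_isPregeometry {p : OneType L M} (hpre : IsPregeometry (ClOp p))
    {a : ℕ → M} (hinj : Function.Injective a)
    (ha : ∀ (T : Finset M) (s : Finset ℕ), T.card < s.card → ∃ i ∈ s, a i ∉ ClOp p T)
    {q : OneType L N} (hq : IsAverage q (fun i => (a i : N))) {κ : Cardinal.{w}} (hκ : #M < κ) :
    IsStronglyRegular κ q (xEqx L) Fin.elim0 := by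
  classical
  refine ⟨hq.isNonAlgebraic (Subtype.val_injective.comp hinj), ?_, (M : Set N), hκ,
    fun i => i.elim0, hq.isInvariant fun i => (a i).2, ?_⟩
  · by_contra hno
    obtain ⟨x, hx⟩ := ((inType_not _ _ _).2 hno).exists_holds
    exact (holds_not _ _ _).1 hx (by simp [Holds, xEqx])
  intro B hB x _
  refine or_iff_not_imp_left.2 fun hx => ?_
  unfold Realizes at hx
  push Not at hx
  obtain ⟨n, φ, b, hbB, hφ, hxφ⟩ := hx
  intro m θ c hc hθ
  let S : Finset (Fin m) := Finset.univ.filter fun i => c i ∉ B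
  -- Entries outside `B` equal `x` and are overwritten through `S`; the filler `a 0` keeps the
  -- parameters in `B`.
  let b' : Fin m → N := fun i => if c i ∈ B then c i else a 0
  have hb' : replace S b' x = c := by
    funext i
    by_cases hi : c i ∈ B
    · simp [replace, S, b', hi]
    · simpa [replace, S, hi] using ((hc i).resolve_left hi).symm
  obtain ⟨k, ψ, g, hψ⟩ := exists_formula_fin
    (regularityFormula φ θ S (δ := Fin (2 * Fintype.card (Fin n) + 1)))
  have hin := inType_regularityFormula hpre ha hq θ S hφ b'
  refine ⟨k, ψ, _ ∘ g, ?_, hin.mono fun z hz => (hψ N _ _).2 hz, fun z hz => ?_⟩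
  · have hall : ∀ i, (Sum.elim (Sum.elim b b') fun i => ((segments a
        (2 * Fintype.card (Fin n) + 1) (2 * Fintype.card (Fin m) + 1) i : M) : N)) i ∈ B := by
      rintro ((i | i) | i)
      · exact hbB i
      · by_cases hi : c i ∈ B
        · simp [b', hi]
        · simpa [b', hi] using hB (a 0).2
      · exact hB (Subtype.coe_prop _)
    exact fun i => hall _
  · have h1 := (hψ N _ _).1 hz
    have e : (fun i => ((segments a
        (2 * Fintype.card (Fin n) + 1) (2 * Fintype.card (Fin m) + 1) i : M) : N)) =
        Sum.elim (fun i : Fin _ => (a i : N)) (fun i : Fin _ => (a i : N)) := by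
      funext i
      rcases i with i | i <;> rfl
    rw [e, holds_regularityFormula] at h1
    have h2 := (h1 x).resolve_left hxφ
    rw [hb'] at h2
    exact h2 ((hq.realize_majority θ c).2 hθ)

end Regular

end GlobalTypes

/-- Here `N` is the monster model, "small" means "of cardinality `< κ`", and `M` is a small
elementary submodel of `N`. -/
theorem theorem7p6 {L : FirstOrder.Language.{u, v}} {N : Type w} [L.Structure N]
    (κ : Cardinal.{w}) (hN : IsSaturated L κ N)
    (M : L.ElementarySubstructure N) (hM : Cardinal.mk M < κ)
    (p : OneType L M)
    (hpre : IsPregeometry (ClOp p)) (hdim : IsInfiniteDimensional (ClOp p)) :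
    IsDefinableType p ∧
      ∃ q : OneType L N, IsHeir p q ∧ (∀ q' : OneType L N, IsHeir p q' → q' = q) ∧
        IsGenericallyStable κ q ∧ IsStronglyRegular κ q (xEqx L) Fin.elim0 := by
  obtain ⟨a, hinj, ha⟩ := hpre.exists_sequence hdim
  have hp : IsAverage p a := isAverage_of_notMem_closure ha
  obtain ⟨q, hq⟩ := hp.exists_extension
  exact ⟨hp.isDefinableType, q, hp.isHeir hq, fun q' hq' => hp.eq_of_isHeir hq hq',
    hq.isGenericallyStable (Subtype.val_injective.comp hinj) (A := (M : Set N)) hM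
      fun i => (a i).2,
    isStronglyRegular_of_isPregeometry hpre hinj ha hq hM⟩
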